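/- Let $V$ be a finite-dimensional real vector space and let $\mathbf{P}=\mathbf{P}(V)$ be its real projective space, with the quotient topology from the projection $\pi\colon V\setminus\{0\}\to\mathbf{P}$ that sends a nonzero vector to the line it spans. For distinct points $p=\pi(u)$ and $q=\pi(v)$ of $\mathbf{P}$, the two line segments joining $p$ and $q$ are $$\{\pi(\lambda u+\mu v) : \lambda,\mu\in\mathbb{R},\ \lambda\mu\ge 0,\ (\lambda,\mu)\ne(0,0)\}\quad\text{and}\quad\{\pi(\lambda u+\mu v) : \lambda,\mu\in\mathbb{R},\ \lambda\mu\le 0,\ (\lambda,\mu)\ne(0,0)\}.$$ A subset $S\subseteq\mathbf{P}$ is a (projective) convex set if any two distinct points of $S$ are joined by a line segment contained in $S$ and some projective hyperplane (the set of lines contained in a linear subspace of $V$ of codimension one) is disjoint from $S$. A multi-convex set is the intersection of a nonempty family of convex sets. Let $C\subseteq\mathbf{P}$ be a multi-convex set, and let $p\in\mathbf{P}$ be a point not in the topological interior $\operatorname{int} C$ of $C$. Then there exists an open convex set $U\subseteq\mathbf{P}$ with $\operatorname{int} C\subseteq U$ and $p\notin U$. -/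

import Mathlib

open scoped LinearAlgebra.Projectivization

namespace RealProj

/-- The topology of a real projective space: the quotient topology along the projection
`V ∖ {0} → ℙ ℝ V`. -/
noncomputable instance instTopologicalSpace {V : Type*} [AddCommGroup V] [Module ℝ V] [TopologicalSpace V] :
    TopologicalSpace (ℙ ℝ V) :=
  TopologicalSpace.coinduced (Projectivization.mk' ℝ : {v : V // v ≠ 0} → ℙ ℝ V) inferInstance

variable {V : Type*} [AddCommGroup V] [Module ℝ V]

/-- The points `π (a u + b v)` with `a b ≥ 0` and `a, b` not both zero. -/
def posSegment (u v : V) : Set (ℙ ℝ V) :=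
  {x | ∃ (a b : ℝ) (h : a • u + b • v ≠ 0), 0 ≤ a * b ∧ (a ≠ 0 ∨ b ≠ 0) ∧
    x = Projectivization.mk ℝ (a • u + b • v) h}

/-- The points `π (a u + b v)` with `a b ≤ 0` and `a, b` not both zero. -/
def negSegment (u v : V) : Set (ℙ ℝ V) :=
  {x | ∃ (a b : ℝ) (h : a • u + b • v ≠ 0), a * b ≤ 0 ∧ (a ≠ 0 ∨ b ≠ 0) ∧
    x = Projectivization.mk ℝ (a • u + b • v) h}

/-- `L` is one of the two projective line segments joining `p` and `q` (used for `p ≠ q`, where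
the vector `a u + b v` in the definitions above is automatically nonzero). -/
def IsLineSegment (p q : ℙ ℝ V) (L : Set (ℙ ℝ V)) : Prop :=
  ∃ (u v : V) (hu : u ≠ 0) (hv : v ≠ 0),
    Projectivization.mk ℝ u hu = p ∧ Projectivization.mk ℝ v hv = q ∧
    (L = posSegment u v ∨ L = negSegment u v)

/-- Any two distinct points of `S` are joined by a line segment contained in `S`. -/
def IsSemiconvex (S : Set (ℙ ℝ V)) : Prop :=
  ∀ p ∈ S, ∀ q ∈ S, p ≠ q → ∃ L, IsLineSegment p q L ∧ L ⊆ S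

/-- A projective hyperplane: the set of lines contained in a linear subspace of codimension one. -/
def IsHyperplane (H : Set (ℙ ℝ V)) : Prop :=
  ∃ W : Submodule ℝ V, Module.finrank ℝ W + 1 = Module.finrank ℝ V ∧
    H = {x | x.submodule ≤ W}

/-- A projective convex set: semiconvex, and avoided by some projective hyperplane. -/
def IsConvex (S : Set (ℙ ℝ V)) : Prop :=
  IsSemiconvex S ∧ ∃ H, IsHyperplane H ∧ Disjoint H S

/-- A multi-convex set: the intersection of a nonempty family of projective convex sets. -/
def IsMultiConvex (C : Set (ℙ ℝ V)) : Prop :=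
  ∃ F : Set (Set (ℙ ℝ V)), F.Nonempty ∧ (∀ N ∈ F, IsConvex N) ∧ C = ⋂₀ F

end RealProj

namespace RealProj

variable {V : Type*} [AddCommGroup V] [Module ℝ V]

/-! If `interior C` is empty, take `U = ∅`. Otherwise `U` is the complement of a hyperplane through
`p` that misses `interior C`. For a point outside `C` itself, some member `N` of the family omits
it, and Hahn–Banach in an affine chart containing `N` gives a hyperplane through the point missing
`interior N` (`IsConvex.exists_interior_subset_kerCompl`). A point of `C` outside `interior C` is a
limit of such points. Normalized linear forms range over a compact sphere, so the points lying on
hyperplanes that miss `interior C` form a closed set (`isClosed_setOf_exists_form`), which therefore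
contains `p`. -/

/-- The nonzero vectors that span a line belonging to `S`. -/
def cone (S : Set (ℙ ℝ V)) : Set V :=
  {v | ∃ h : v ≠ 0, Projectivization.mk ℝ v h ∈ S}

theorem cone_mono {S T : Set (ℙ ℝ V)} (h : S ⊆ T) : cone S ⊆ cone T :=
  fun _ hv => ⟨hv.1, h hv.2⟩

theorem rep_mem_cone {S : Set (ℙ ℝ V)} {x : ℙ ℝ V} : x.rep ∈ cone S ↔ x ∈ S := by
  refine ⟨fun ⟨_, h⟩ => ?_, fun h => ⟨x.rep_nonzero, ?_⟩⟩
  · rwa [Projectivization.mk_rep] at h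
  · rwa [Projectivization.mk_rep]

theorem smul_mem_cone {S : Set (ℙ ℝ V)} {v : V} {t : ℝ} (ht : t ≠ 0) (hv : v ∈ cone S) :
    t • v ∈ cone S := by
  obtain ⟨h, hS⟩ := hv
  refine ⟨smul_ne_zero ht h, ?_⟩
  rwa [(Projectivization.mk_eq_mk_iff' ℝ (t • v) v (smul_ne_zero ht h) h).2 ⟨t, rfl⟩]

theorem isOpen_iff_isOpen_cone [TopologicalSpace V] [T1Space V] {S : Set (ℙ ℝ V)} :
    IsOpen S ↔ IsOpen (cone S) := by
  have himage : cone S =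
      Subtype.val '' ((Projectivization.mk' ℝ : {v : V // v ≠ 0} → ℙ ℝ V) ⁻¹' S) := by
    ext v
    constructor
    · rintro ⟨h, hS⟩
      exact ⟨⟨v, h⟩, hS, rfl⟩
    · rintro ⟨w, hw, rfl⟩
      exact ⟨w.2, hw⟩
  rw [isOpen_coinduced, himage]
  exact (IsOpen.isOpenEmbedding_subtypeVal
    (isOpen_compl_singleton (x := (0 : V)))).isOpen_iff_image_isOpen

/-! ### Complements of hyperplanes -/

/-- The points represented by vectors off the kernel of a linear form. -/
def kerCompl (f : V →ₗ[ℝ] ℝ) : Set (ℙ ℝ V) := {x | f x.rep ≠ 0}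

theorem cone_kerCompl (f : V →ₗ[ℝ] ℝ) : cone (kerCompl f) = {v | f v ≠ 0} := by
  ext v
  constructor
  · rintro ⟨h, hv⟩ hf
    obtain ⟨a, ha⟩ := Projectivization.exists_smul_eq_mk_rep ℝ v h
    apply hv
    rw [← ha, Units.smul_def, map_smul, hf, smul_zero]
  · intro hv
    have h : v ≠ 0 := by
      rintro rfl
      exact hv (map_zero f)
    refine ⟨h, fun hf => hv ?_⟩
    obtain ⟨a, ha⟩ := Projectivization.exists_smul_eq_mk_rep ℝ v h
    rw [← ha, Units.smul_def, map_smul, smul_eq_mul] at hf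
    exact (mul_eq_zero.1 hf).resolve_left a.ne_zero

theorem isOpen_kerCompl [FiniteDimensional ℝ V] [TopologicalSpace V] [IsTopologicalAddGroup V]
    [ContinuousSMul ℝ V] [T2Space V] (f : V →ₗ[ℝ] ℝ) : IsOpen (kerCompl f) := by
  rw [isOpen_iff_isOpen_cone, cone_kerCompl]
  exact isOpen_ne_fun f.continuous_of_finiteDimensional continuous_const

/-- A point where `f` does not vanish is represented by a vector on which `f` is positive. -/
theorem exists_mk_eq_pos {f : V →ₗ[ℝ] ℝ} {x : ℙ ℝ V} (hx : x ∈ kerCompl f) :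
    ∃ (v : V) (h : v ≠ 0), Projectivization.mk ℝ v h = x ∧ 0 < f v := by
  have hx' : f x.rep ≠ 0 := hx
  refine ⟨f x.rep • x.rep, smul_ne_zero hx' x.rep_nonzero, ?_, ?_⟩
  · conv_rhs => rw [← x.mk_rep]
    exact (Projectivization.mk_eq_mk_iff' ℝ _ _ _ _).2 ⟨_, rfl⟩
  · rw [map_smul, smul_eq_mul]
    exact mul_self_pos.2 hx'

/-- With `f` positive on both representatives, coefficients of the same sign cannot make `f` vanish
on the combination. -/
theorem isSemiconvex_kerCompl (f : V →ₗ[ℝ] ℝ) : IsSemiconvex (kerCompl f) := by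
  intro p hp q hq _
  obtain ⟨u, hu, rfl, hfu⟩ := exists_mk_eq_pos hp
  obtain ⟨v, hv, rfl, hfv⟩ := exists_mk_eq_pos hq
  refine ⟨posSegment u v, ⟨u, v, hu, hv, rfl, rfl, Or.inl rfl⟩, ?_⟩
  rintro _ ⟨a, b, h, hab, hne, rfl⟩
  have hf : a • u + b • v ∈ cone (kerCompl f) := by
    rw [cone_kerCompl]
    change f (a • u + b • v) ≠ 0
    rw [map_add, map_smul, map_smul, smul_eq_mul, smul_eq_mul]
    intro h0
    have ha : a * (a * f u + b * f v) = 0 := by rw [h0, mul_zero]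
    have hb : b * (a * f u + b * f v) = 0 := by rw [h0, mul_zero]
    have ha2 : a * a * f u = 0 := le_antisymm
      (by nlinarith [mul_nonneg hab hfv.le]) (mul_nonneg (mul_self_nonneg a) hfu.le)
    have hb2 : b * b * f v = 0 := le_antisymm
      (by nlinarith [mul_nonneg hab hfu.le]) (mul_nonneg (mul_self_nonneg b) hfv.le)
    rcases hne with h | h
    · exact h (by simpa [hfu.ne'] using ha2)
    · exact h (by simpa [hfv.ne'] using hb2)
  exact hf.2

theorem isHyperplane_compl_kerCompl [FiniteDimensional ℝ V] {f : V →ₗ[ℝ] ℝ} (hf : f ≠ 0) :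
    IsHyperplane (kerCompl f)ᶜ := by
  refine ⟨LinearMap.ker f, ?_, ?_⟩
  · exact Module.Dual.finrank_ker_add_one_of_ne_zero hf
  · ext x
    rw [Set.mem_compl_iff, Set.mem_ofPred_eq, Projectivization.submodule_eq,
      Submodule.span_singleton_le_iff_mem, LinearMap.mem_ker]
    exact not_not

theorem isConvex_kerCompl [FiniteDimensional ℝ V] {f : V →ₗ[ℝ] ℝ} (hf : f ≠ 0) :
    IsConvex (kerCompl f) :=
  ⟨isSemiconvex_kerCompl f, _, isHyperplane_compl_kerCompl hf, disjoint_compl_left⟩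

theorem IsHyperplane.exists_eq_compl_kerCompl [FiniteDimensional ℝ V] {H : Set (ℙ ℝ V)}
    (hH : IsHyperplane H) : ∃ f : V →ₗ[ℝ] ℝ, f ≠ 0 ∧ H = (kerCompl f)ᶜ := by
  obtain ⟨W, hW, rfl⟩ := hH
  have hlt : W < ⊤ := by
    refine lt_top_iff_ne_top.2 fun h => ?_
    rw [h, finrank_top] at hW
    omega
  obtain ⟨f, hf, hWf⟩ := W.exists_le_ker_of_lt_top hlt
  have hker : W = LinearMap.ker f := by
    refine Submodule.eq_of_le_of_finrank_eq hWf ?_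
    have := Module.Dual.finrank_ker_add_one_of_ne_zero hf
    omega
  refine ⟨f, hf, ?_⟩
  ext x
  rw [Set.mem_compl_iff, Set.mem_ofPred_eq, Projectivization.submodule_eq,
    Submodule.span_singleton_le_iff_mem, hker, LinearMap.mem_ker]
  exact not_not.symm

/-! ### Convexity in an affine chart -/

/-- In an affine chart of projective space, a semiconvex set spans a convex cone. -/
theorem IsSemiconvex.convex_cone_inter {N : Set (ℙ ℝ V)} (hN : IsSemiconvex N)
    {g : V →ₗ[ℝ] ℝ} (hg : N ⊆ kerCompl g) : Convex ℝ (cone N ∩ {v | 0 < g v}) := by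
  refine convex_iff_forall_pos.2 ?_
  rintro v ⟨⟨hv, hvN⟩, hgv⟩ w ⟨⟨hw, hwN⟩, hgw⟩ a b ha hb -
  rw [Set.mem_ofPred_eq] at hgv hgw
  have hpos : 0 < g (a • v + b • w) := by
    rw [map_add, map_smul, map_smul, smul_eq_mul, smul_eq_mul]
    positivity
  have hne : a • v + b • w ≠ 0 := by
    intro h
    rw [h, map_zero] at hpos
    exact hpos.false
  refine ⟨⟨hne, ?_⟩, hpos⟩
  by_cases hvw : Projectivization.mk ℝ v hv = Projectivization.mk ℝ w hw
  · obtain ⟨c, rfl⟩ := (Projectivization.mk_eq_mk_iff' ℝ _ _ hv hw).1 hvw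
    have : Projectivization.mk ℝ (a • c • w + b • w) hne = Projectivization.mk ℝ w hw :=
      (Projectivization.mk_eq_mk_iff' ℝ _ _ _ _).2 ⟨a * c + b, by rw [add_smul, mul_smul]⟩
    rwa [this]
  · obtain ⟨L, ⟨v', w', hv', hw', hvv, hww, hL⟩, hLN⟩ := hN _ hvN _ hwN hvw
    obtain ⟨s, rfl⟩ := (Projectivization.mk_eq_mk_iff' ℝ _ _ hv' hv).1 hvv
    obtain ⟨t, rfl⟩ := (Projectivization.mk_eq_mk_iff' ℝ _ _ hw' hw).1 hww
    have hs : s ≠ 0 := fun h => hv' (by rw [h, zero_smul])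
    have ht : t ≠ 0 := fun h => hw' (by rw [h, zero_smul])
    have hcomb : ∀ c d : ℝ, (c / s) • s • v + (d / t) • t • w = c • v + d • w := by
      intro c d
      rw [smul_smul, smul_smul, div_mul_cancel₀ _ hs, div_mul_cancel₀ _ ht]
    -- The line through the two points meets `ker g` here, on the segment that leaves the chart;
    -- hence that segment is not in `N`.
    have hne' : g w • v + (-g v) • w ≠ 0 := by
      intro h
      refine hvw ((Projectivization.mk_eq_mk_iff' ℝ _ _ hv hw).2 ⟨g v / g w, ?_⟩)
      rw [neg_smul, add_neg_eq_zero] at h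
      rw [div_eq_inv_mul, mul_smul, ← h, smul_smul, inv_mul_cancel₀ hgw.ne', one_smul]
    have hker : Projectivization.mk ℝ (g w • v + (-g v) • w) hne' ∉ N := by
      intro h
      have h' : g w • v + (-g v) • w ∈ cone (kerCompl g) := ⟨hne', hg h⟩
      rw [cone_kerCompl] at h'
      apply h'
      simp only [map_add, map_smul, smul_eq_mul]
      ring
    have hquot : ∀ c d : ℝ, c / s * (d / t) = c * d / (s * t) := fun c d => div_mul_div_comm c s d t
    -- Replacing `v, w` by `s • v, t • w` swaps the two segments exactly when `s * t < 0`.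
    rcases lt_or_gt_of_ne (mul_ne_zero hs ht) with hst | hst
    · rcases hL with rfl | rfl
      · refine absurd (hLN ⟨g w / s, -g v / t, by rwa [hcomb], ?_, ?_, ?_⟩) hker
        · rw [hquot]
          exact div_nonneg_of_nonpos (by nlinarith [mul_pos hgw hgv]) hst.le
        · exact Or.inl (div_ne_zero hgw.ne' hs)
        · simp only [hcomb]
      · refine hLN ⟨a / s, b / t, by rwa [hcomb], ?_, ?_, ?_⟩
        · rw [hquot]
          exact div_nonpos_of_nonneg_of_nonpos (mul_pos ha hb).le hst.le
        · exact Or.inl (div_ne_zero ha.ne' hs)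
        · simp only [hcomb]
    · rcases hL with rfl | rfl
      · refine hLN ⟨a / s, b / t, by rwa [hcomb], ?_, ?_, ?_⟩
        · rw [hquot]
          exact div_nonneg (mul_pos ha hb).le hst.le
        · exact Or.inl (div_ne_zero ha.ne' hs)
        · simp only [hcomb]
      · refine absurd (hLN ⟨g w / s, -g v / t, by rwa [hcomb], ?_, ?_, ?_⟩) hker
        · rw [hquot]
          exact div_nonpos_of_nonpos_of_nonneg (by nlinarith [mul_pos hgw hgv]) hst.le
        · exact Or.inl (div_ne_zero hgw.ne' hs)
        · simp only [hcomb]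

/-! ### Coordinates on the space of linear forms -/

/-- A linear form in terms of its coefficients with respect to a fixed basis of `V`. -/
noncomputable def formOfCoeffs [FiniteDimensional ℝ V] (c : Fin (Module.finrank ℝ V) → ℝ) : V →ₗ[ℝ] ℝ :=
  (Module.finBasis ℝ V).constr ℝ c

theorem formOfCoeffs_basis [FiniteDimensional ℝ V] (c : Fin (Module.finrank ℝ V) → ℝ)
    (i : Fin (Module.finrank ℝ V)) : formOfCoeffs c (Module.finBasis ℝ V i) = c i :=
  (Module.finBasis ℝ V).constr_basis ℝ c i

theorem formOfCoeffs_ne_zero [FiniteDimensional ℝ V] {c : Fin (Module.finrank ℝ V) → ℝ}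
    (hc : c ≠ 0) : formOfCoeffs c ≠ 0 := by
  intro h
  apply hc
  funext i
  rw [← formOfCoeffs_basis c i, h]
  rfl

theorem formOfCoeffs_smul_basis [FiniteDimensional ℝ V] (t : ℝ) (f : V →ₗ[ℝ] ℝ) :
    formOfCoeffs (t • fun i => f (Module.finBasis ℝ V i)) = t • f := by
  refine (Module.finBasis ℝ V).ext fun i => ?_
  rw [formOfCoeffs_basis]
  rfl

theorem formOfCoeffs_apply [FiniteDimensional ℝ V] (c : Fin (Module.finrank ℝ V) → ℝ) (v : V) :
    formOfCoeffs c v = ∑ i, (Module.finBasis ℝ V).equivFun v i * c i := by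
  simp [formOfCoeffs, Module.Basis.constr_apply_fintype]

attribute [irreducible] formOfCoeffs

variable [FiniteDimensional ℝ V] [TopologicalSpace V] [IsTopologicalAddGroup V]
  [ContinuousSMul ℝ V] [T2Space V]

/-! ### Separation and compactness -/

/-- Through a point outside a convex set there is a hyperplane that misses its interior. -/
theorem IsConvex.exists_interior_subset_kerCompl {N : Set (ℙ ℝ V)} (hN : IsConvex N)
    {x : ℙ ℝ V} (hx : x ∉ N) :
    ∃ f : V →ₗ[ℝ] ℝ, f x.rep = 0 ∧ interior N ⊆ kerCompl f := by
  obtain ⟨hsemi, H, hH, hdisj⟩ := hN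
  obtain ⟨g, -, rfl⟩ := hH.exists_eq_compl_kerCompl
  have hg : N ⊆ kerCompl g := Set.disjoint_compl_left_iff_subset.1 hdisj
  set K : Set V := cone N ∩ {v | 0 < g v}
  have hK : Convex ℝ (interior K) := (hsemi.convex_cone_inter hg).interior
  have hsub : cone (interior N) ∩ {v | 0 < g v} ⊆ interior K :=
    interior_maximal (Set.inter_subset_inter_left _ (cone_mono interior_subset))
      ((isOpen_iff_isOpen_cone.1 isOpen_interior).inter
        (isOpen_lt continuous_const g.continuous_of_finiteDimensional))
  have hdis : Disjoint (interior K) (Submodule.span ℝ {x.rep} : Set V) := by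
    refine Set.disjoint_left.2 fun v hv hvx => hx ?_
    obtain ⟨t, rfl⟩ := Submodule.mem_span_singleton.1 hvx
    have hmem := (interior_subset hv).1
    have ht : t ≠ 0 := fun h => hmem.1 (by rw [h, zero_smul])
    have := smul_mem_cone (inv_ne_zero ht) hmem
    rwa [smul_smul, inv_mul_cancel₀ ht, one_smul, rep_mem_cone] at this
  obtain ⟨f, c, hfK, hfx⟩ := geometric_hahn_banach_open hK isOpen_interior
    (Submodule.span ℝ {x.rep}).convex hdis
  have hc : c ≤ 0 := by
    have := hfx 0 (Submodule.zero_mem _)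
    rwa [map_zero] at this
  -- A linear form bounded below on a line through the origin vanishes on it; the multiple below
  -- would take the value `c - 1`.
  have hfx0 : f x.rep = 0 := by
    by_contra h
    have := hfx (((c - 1) / f x.rep) • x.rep)
      (Submodule.smul_mem _ _ (Submodule.mem_span_singleton_self _))
    rw [map_smul, smul_eq_mul, div_mul_cancel₀ _ h] at this
    linarith
  refine ⟨f.toLinearMap, hfx0, fun y hy => ?_⟩
  obtain ⟨v, hv, rfl, hgv⟩ := exists_mk_eq_pos (hg (interior_subset hy))
  have hfv := hfK v (hsub ⟨⟨hv, hy⟩, hgv⟩)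
  have hvf : v ∈ cone (kerCompl f.toLinearMap) := by
    rw [cone_kerCompl]
    exact (hfv.trans_le hc).ne
  exact hvf.2

theorem _root_.Continuous.formOfCoeffs {X : Type*} [TopologicalSpace X]
    {c : X → Fin (Module.finrank ℝ V) → ℝ} {v : X → V} (hc : Continuous c) (hv : Continuous v) :
    Continuous fun x => formOfCoeffs (c x) (v x) := by
  have hcont : Continuous (Module.finBasis ℝ V).equivFun :=
    (Module.finBasis ℝ V).equivFun.toLinearMap.continuous_of_finiteDimensional
  simp only [formOfCoeffs_apply]
  fun_prop

/-- Being nonzero throughout a given open set is a closed condition on nonzero linear forms. -/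
theorem isClosed_coeffs_nonvanishing {O : Set V} (hO : IsOpen O) :
    IsClosed {c : Metric.sphere (0 : Fin (Module.finrank ℝ V) → ℝ) 1 |
      ∀ v ∈ O, formOfCoeffs c.1 v ≠ 0} := by
  rw [← isOpen_compl_iff, isOpen_iff_mem_nhds]
  intro c hc
  simp only [Set.mem_compl_iff, Set.mem_ofPred_eq, not_forall, not_not] at hc
  obtain ⟨v, hv, hcv⟩ := hc
  obtain ⟨w, hw⟩ : ∃ w : V, formOfCoeffs c.1 w ≠ 0 := by
    by_contra! h
    exact formOfCoeffs_ne_zero (ne_zero_of_mem_unit_sphere c) (LinearMap.ext h)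
  have hcont : ∀ z : V, Continuous
      fun d : Metric.sphere (0 : Fin (Module.finrank ℝ V) → ℝ) 1 => formOfCoeffs d.1 z :=
    fun z => continuous_subtype_val.formOfCoeffs continuous_const
  -- Correcting `v` along `w` yields a zero of `d` that tends to `v` as `d` tends to `c`, so it lies
  -- in `O` for `d` near `c`.
  have htend : ContinuousAt (fun d : Metric.sphere (0 : Fin (Module.finrank ℝ V) → ℝ) 1 =>
      v - (formOfCoeffs d.1 v / formOfCoeffs d.1 w) • w) c :=
    continuousAt_const.sub
      (((hcont v).continuousAt.div (hcont w).continuousAt hw).smul continuousAt_const)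
  have hnear := htend.preimage_mem_nhds (t := O)
    (hO.mem_nhds (by simpa only [hcv, zero_div, zero_smul, sub_zero] using hv))
  filter_upwards [hnear, (hcont w).continuousAt.eventually_ne hw] with d hd hdw hall
  refine hall _ hd ?_
  rw [map_sub, map_smul, smul_eq_mul, div_mul_cancel₀ _ hdw, sub_self]

/-- The vectors annihilated by some nonzero linear form without zeros in a given open set form a
closed set. -/
theorem isClosed_setOf_exists_form {O : Set V} (hO : IsOpen O) :
    IsClosed {y : V | ∃ f : V →ₗ[ℝ] ℝ, f ≠ 0 ∧ (∀ v ∈ O, f v ≠ 0) ∧ f y = 0} := by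
  have hcl : IsClosed {z : Metric.sphere (0 : Fin (Module.finrank ℝ V) → ℝ) 1 × V |
      (∀ v ∈ O, formOfCoeffs z.1.1 v ≠ 0) ∧ formOfCoeffs z.1.1 z.2 = 0} :=
    ((isClosed_coeffs_nonvanishing hO).preimage continuous_fst).inter
      (isClosed_eq ((continuous_subtype_val.comp continuous_fst).formOfCoeffs continuous_snd)
        continuous_const)
  convert isClosedMap_snd_of_compactSpace _ hcl using 1
  ext y
  constructor
  · rintro ⟨f, hf, hfO, hfy⟩
    set c : Fin (Module.finrank ℝ V) → ℝ := fun i => f (Module.finBasis ℝ V i)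
    have hc : c ≠ 0 := fun h =>
      hf ((Module.finBasis ℝ V).ext fun i => by simpa using congrFun h i)
    have hform : ∀ v, formOfCoeffs (‖c‖⁻¹ • c) v = ‖c‖⁻¹ * f v := fun v =>
      LinearMap.congr_fun (formOfCoeffs_smul_basis ‖c‖⁻¹ f) v
    refine ⟨(⟨‖c‖⁻¹ • c, ?_⟩, y), ⟨fun v hv => ?_, ?_⟩, rfl⟩
    · rw [mem_sphere_zero_iff_norm, norm_smul, norm_inv, norm_norm,
        inv_mul_cancel₀ (norm_ne_zero_iff.2 hc)]
    · rw [hform]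
      exact mul_ne_zero (inv_ne_zero (norm_ne_zero_iff.2 hc)) (hfO v hv)
    · rw [hform, hfy, mul_zero]
  · rintro ⟨⟨c, y⟩, ⟨hcO, hcy⟩, rfl⟩
    exact ⟨formOfCoeffs c.1, formOfCoeffs_ne_zero (ne_zero_of_mem_unit_sphere c), hcO, hcy⟩

/-- Through a point outside the interior of a multi-convex set there is a hyperplane that misses
this interior, provided that it is nonempty. -/
theorem IsMultiConvex.exists_interior_subset_kerCompl {C : Set (ℙ ℝ V)} (hC : IsMultiConvex C)
    (hne : (interior C).Nonempty) {p : ℙ ℝ V} (hp : p ∉ interior C) :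
    ∃ f : V →ₗ[ℝ] ℝ, f ≠ 0 ∧ f p.rep = 0 ∧ interior C ⊆ kerCompl f := by
  obtain ⟨F, -, hF, rfl⟩ := hC
  set A : Set V :=
    {y : V | ∃ f : V →ₗ[ℝ] ℝ, f ≠ 0 ∧ (∀ v ∈ cone (interior (⋂₀ F)), f v ≠ 0) ∧ f y = 0}
  have hA : IsClosed A := isClosed_setOf_exists_form (isOpen_iff_isOpen_cone.1 isOpen_interior)
  have hkey : ∀ x : ℙ ℝ V, x ∉ ⋂₀ F → x.rep ∈ A := by
    intro x hx
    obtain ⟨N, hN, hxN⟩ : ∃ N ∈ F, x ∉ N := by simpa using hx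
    obtain ⟨f, hfx, hf⟩ := (hF N hN).exists_interior_subset_kerCompl hxN
    have hsub := (interior_mono (Set.sInter_subset_of_mem hN)).trans hf
    refine ⟨f, ?_, fun v hv => ?_, hfx⟩
    -- Separation may return the zero form, but that has no nonvanishing points, whereas `interior
    -- (⋂₀ F)` is nonempty.
    · rintro rfl
      obtain ⟨y, hy⟩ := hne
      exact hsub hy rfl
    · have := cone_mono hsub hv
      rwa [cone_kerCompl] at this
  have hmem : p.rep ∈ A := by
    by_contra hpA
    have hcone : cone {x : ℙ ℝ V | x.rep ∉ A} = Aᶜ ∩ {0}ᶜ := by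
      ext v
      constructor
      · rintro ⟨h, hv⟩
        refine ⟨fun ⟨f, hf, hfO, hfv⟩ => hv ⟨f, hf, hfO, ?_⟩, h⟩
        obtain ⟨a, ha⟩ := Projectivization.exists_smul_eq_mk_rep ℝ v h
        rw [← ha, Units.smul_def, map_smul, hfv, smul_zero]
      · rintro ⟨hv, h⟩
        refine ⟨h, fun ⟨f, hf, hfO, hfv⟩ => hv ⟨f, hf, hfO, ?_⟩⟩
        obtain ⟨a, ha⟩ := Projectivization.exists_smul_eq_mk_rep ℝ v h
        rw [← ha, Units.smul_def, map_smul, smul_eq_mul] at hfv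
        exact (mul_eq_zero.1 hfv).resolve_left a.ne_zero
    have hopen : IsOpen {x : ℙ ℝ V | x.rep ∉ A} := by
      rw [isOpen_iff_isOpen_cone, hcone]
      exact hA.isOpen_compl.inter isOpen_compl_singleton
    refine hp (interior_maximal (fun x hx => ?_) hopen hpA)
    by_contra hxC
    exact hx (hkey x hxC)
  obtain ⟨f, hf, hfO, hfp⟩ := hmem
  exact ⟨f, hf, hfp, fun y hy => hfO _ (rep_mem_cone.2 hy)⟩

end RealProj

theorem mainTheorem9 {V : Type*} [AddCommGroup V] [Module ℝ V] [FiniteDimensional ℝ V]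
    [TopologicalSpace V] [IsTopologicalAddGroup V] [ContinuousSMul ℝ V] [T2Space V]
    (C : Set (ℙ ℝ V)) (hC : RealProj.IsMultiConvex C) (p : ℙ ℝ V) (hp : p ∉ interior C) :
    ∃ U : Set (ℙ ℝ V), IsOpen U ∧ RealProj.IsConvex U ∧ interior C ⊆ U ∧ p ∉ U := by
  rcases (interior C).eq_empty_or_nonempty with hempty | hne
  -- Convexity of `∅` still requires a hyperplane to exist; a member of the family supplies one.
  · obtain ⟨F, ⟨N, hN⟩, hF, -⟩ := hC
    obtain ⟨H, hH, -⟩ := (hF N hN).2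
    exact ⟨∅, isOpen_empty, ⟨fun x hx => hx.elim, H, hH, Set.disjoint_empty H⟩,
      hempty.subset, id⟩
  · obtain ⟨f, hf, hfp, hsub⟩ := hC.exists_interior_subset_kerCompl hne hp
    exact ⟨RealProj.kerCompl f, RealProj.isOpen_kerCompl f, RealProj.isConvex_kerCompl hf, hsub,
      fun h => h hfp⟩
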